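/- For graphs $F$, $H$, $G$ write $F \xrightarrow{\mathrm{ind}} (H,G)$ if every colouring of the edges of $F$ with red and blue contains an induced subgraph of $F$ isomorphic to $H$ with all its edges red, or an induced subgraph of $F$ isomorphic to $G$ with all its edges blue. Let $\mathrm{IR}(H,G)$ be the smallest number of vertices of a finite graph $F$ with $F \xrightarrow{\mathrm{ind}} (H,G)$, and let $K_{1,n}$ denote the star with $n$ edges. Theorem. For every real $\gamma>0$ and every finite graph $H$ with chromatic number $r$ there is $n_0\in\mathbb{N}$ such that for every $n>n_0$ $$\mathrm{IR}(H,K_{1,n}) \le (r-1)^2 n + \gamma n .$$ -/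

import Mathlib

/-- `HasMonoInducedCopy F c k A`: under the edge colouring `c` of `F` there is an induced copy of
`A` in `F` (a graph embedding, preserving adjacency and non-adjacency) all of whose edges receive
the colour `k`. -/
def HasMonoInducedCopy {W U K : Type*} (F : SimpleGraph W) (c : F.EdgeLabeling K) (k : K)
    (A : SimpleGraph U) : Prop :=
  ∃ f : A ↪g F, ∀ (u v : U) (h : A.Adj u v), c.get (f u) (f v) (f.map_adj_iff.mpr h) = k

/-- The induced arrow relation `F →ind (H, G)`: every colouring of the edges of `F` in red (`true`)
and blue (`false`) has a red induced copy of `H` or a blue induced copy of `G`. -/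
def InducedArrows {W U U' : Type*} (F : SimpleGraph W) (H : SimpleGraph U)
    (G : SimpleGraph U') : Prop :=
  ∀ c : F.EdgeLabeling Bool, HasMonoInducedCopy F c true H ∨ HasMonoInducedCopy F c false G

/-- The set of all orders of finite graphs `F` with `F →ind (H, G)`. -/
def inducedRamseyOrders {U U' : Type*} (H : SimpleGraph U) (G : SimpleGraph U') : Set ℕ :=
  {N | ∃ F : SimpleGraph (Fin N), InducedArrows F H G}

/-- The induced Ramsey number `IR(H, G)`: the least number of vertices of a graph `F` with
`F →ind (H, G)`. It is meaningful when `inducedRamseyOrders H G` is nonempty. -/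
noncomputable def inducedRamseyNumber {U U' : Type*} (H : SimpleGraph U)
    (G : SimpleGraph U') : ℕ :=
  sInf (inducedRamseyOrders H G)

/-- The star `K_{1,n}` with `n` edges. -/
abbrev starK (n : ℕ) : SimpleGraph (Fin 1 ⊕ Fin n) :=
  completeBipartiteGraph (Fin 1) (Fin n)

/-! Take an `r`-partite graph whose part `j` has slightly more than `j * n` vertices, complete
between parts except for a sparse pseudorandom set of nonadjacent pairs, the holes. Parts are
independent, so without a blue induced star every vertex has fewer than `n` blue neighbours in each
other part. Choosing vertices part by part, the `j` vertices already chosen exclude fewer than `j *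
n` vertices of part `j` through blue edges and few through holes, so a positive proportion of
transversals are red cliques (`pow_le_sum_clique`).

By Jensen's inequality, blow-ups of a red clique with `|V|` vertices in each part also have positive
density (`pow_sum_le_sum_blowup`). The red graph is arbitrary, but the holes are uniform against all
pairs of weight functions. Red edges can therefore be kept where `H` has edges and holes imposed
elsewhere, each hole costing a factor `1 / (q + 1)` and a small error (`pow_mul_sum_le_sum_add`).
The count stays positive after noninjective choices are discarded, and placing each vertex of `H` in
the part of its colour gives a red induced copy.

The holes are explicit: a vertex carries a coordinate and a word, and a hole is a zero of the later
word at the earlier coordinate. Letters at distinct coordinates are independent, which gives exact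
orthogonality and hence small discrepancy. The total size is about `r * (r - 1) / 2 * n`, which is
at most `(r - 1) ^ 2 * n`. -/

open Finset

/-! ### Finite probability weights and resampling -/

/-- A probability weight on a finite type. -/
structure IsProbWeight {W : Type*} [Fintype W] (μ : W → ℝ) : Prop where
  nonneg : ∀ w, 0 ≤ μ w
  sum_eq_one : ∑ w, μ w = 1

namespace IsProbWeight

variable {W I : Type*} [Fintype W] [Fintype I]

theorem sum_mul_le {μ : W → ℝ} (hμ : IsProbWeight μ) {f : W → ℝ} {b : ℝ} (hf : ∀ w, f w ≤ b) :
    ∑ w, μ w * f w ≤ b := by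
  calc ∑ w, μ w * f w ≤ ∑ w, μ w * b :=
        sum_le_sum fun w _ => mul_le_mul_of_nonneg_left (hf w) (hμ.nonneg w)
    _ = b := by rw [← sum_mul, hμ.sum_eq_one, one_mul]

theorem abs_sum_mul_le {μ : W → ℝ} (hμ : IsProbWeight μ) {f : W → ℝ} {b : ℝ}
    (hf : ∀ w, |f w| ≤ b) : |∑ w, μ w * f w| ≤ b := by
  refine (abs_sum_le_sum_abs _ _).trans ?_
  simp_rw [abs_mul, abs_of_nonneg (hμ.nonneg _)]
  exact hμ.sum_mul_le hf

theorem pow_sum_le {μ : W → ℝ} (hμ : IsProbWeight μ) {f : W → ℝ} (hf : ∀ w, 0 ≤ f w) (n : ℕ) :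
    (∑ w, μ w * f w) ^ n ≤ ∑ w, μ w * f w ^ n :=
  Real.pow_arith_mean_le_arith_mean_pow _ _ _ (fun w _ => hμ.nonneg w) hμ.sum_eq_one
    (fun w _ => hf w) n

theorem pi [DecidableEq I] {μ : I → W → ℝ} (hμ : ∀ i, IsProbWeight (μ i)) :
    IsProbWeight fun x : I → W => ∏ i, μ i (x i) where
  nonneg x := prod_nonneg fun i _ => (hμ i).nonneg _
  sum_eq_one := by
    rw [← Fintype.prod_sum]
    exact prod_eq_one fun i _ => (hμ i).sum_eq_one

/-- Resampling one coordinate does not change the mean under a product weight. -/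
theorem sum_pi_update [DecidableEq I] {μ : I → W → ℝ} (hμ : ∀ i, IsProbWeight (μ i)) (u : I)
    (F : (I → W) → ℝ) :
    ∑ x : I → W, (∏ i, μ i (x i)) * F x
      = ∑ x : I → W, (∏ i, μ i (x i)) * ∑ a, μ u a * F (Function.update x u a) := by
  have h1 : ∑ x : I → W, (∏ i, μ i (x i)) * F x
      = ∑ z : (I → W) × W, ((∏ i, μ i (z.1 i)) * μ u z.2) * F z.1 := by
    rw [Fintype.sum_prod_type]
    refine sum_congr rfl fun x _ => ?_
    simp only
    rw [← sum_mul, ← mul_sum, (hμ u).sum_eq_one, mul_one]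
  have h2 : ∑ x : I → W, (∏ i, μ i (x i)) * ∑ a, μ u a * F (Function.update x u a)
      = ∑ z : (I → W) × W, ((∏ i, μ i (z.1 i)) * μ u z.2) * F (Function.update z.1 u z.2) := by
    rw [Fintype.sum_prod_type]
    refine sum_congr rfl fun x _ => ?_
    rw [mul_sum]
    exact sum_congr rfl fun a _ => by ring
  rw [h1, h2]
  -- Exchanging the old value at `u` with the fresh sample is an involution preserving the joint
  -- weight.
  let e : (I → W) × W → (I → W) × W := fun z => (Function.update z.1 u z.2, z.1 u)
  have he : Function.Involutive e := fun z => by simp [e]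
  refine (Fintype.sum_equiv he.toPerm _ _ fun z => ?_).symm
  have : (∏ i, μ i (z.1 i)) * μ u z.2 = (∏ i, μ i (Function.update z.1 u z.2 i)) * μ u (z.1 u) := by
    rw [Fintype.prod_eq_mul_prod_compl u, Fintype.prod_eq_mul_prod_compl u]
    have : ∏ i ∈ {u}ᶜ, μ i (Function.update z.1 u z.2 i) = ∏ i ∈ {u}ᶜ, μ i (z.1 i) := by
      refine prod_congr rfl fun i hi => ?_
      rw [Function.update_of_ne (by simpa using hi)]
    rw [this, Function.update_self]
    ring
  simp only [Function.Involutive.coe_toPerm, e]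
  rw [this]

/-- Freezing all coordinates but two lets a two-variable estimate, uniform in the frozen ones, pass
to the whole sum. -/
theorem sum_pi_update_update [DecidableEq I] {μ : I → W → ℝ} (hμ : ∀ i, IsProbWeight (μ i))
    (u v : I) (F : (I → W) → ℝ) :
    ∑ x : I → W, (∏ i, μ i (x i)) * F x
      = ∑ x : I → W, (∏ i, μ i (x i)) *
        ∑ a, ∑ b, μ u a * μ v b * F (Function.update (Function.update x u a) v b) := by
  rw [sum_pi_update hμ v, sum_pi_update hμ u]
  simp only [mul_sum, mul_assoc]

end IsProbWeight

/-! ### Counting transversal cliques and their blow-ups -/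

theorem sum_fun_fin_succ {W : Type*} [Fintype W] (r : ℕ) (F : (Fin (r + 1) → W) → ℝ) :
    ∑ x, F x = ∑ a : W, ∑ y : Fin r → W, F (Fin.cons a y) := by
  rw [← Fintype.sum_prod_type']
  exact (Fintype.sum_equiv (Fin.consEquiv fun _ => W) _ _ fun _ => rfl).symm

theorem prod_fun_fin_succ {W : Type*} [Fintype W] (r : ℕ) (F : (Fin (r + 1) → W) → ℝ) :
    ∏ x, F x = ∏ a : W, ∏ y : Fin r → W, F (Fin.cons a y) := by
  rw [← Fintype.prod_prod_type']
  exact (Fintype.prod_equiv (Fin.consEquiv fun _ => W) _ _ fun _ => rfl).symm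

theorem sum_fun_fin_snoc {W : Type*} [Fintype W] (r : ℕ) (F : (Fin (r + 1) → W) → ℝ) :
    ∑ x, F x = ∑ y : Fin r → W, ∑ a : W, F (Fin.snoc (α := fun _ => W) y a) := by
  rw [sum_comm, ← Fintype.sum_prod_type']
  exact (Fintype.sum_equiv (Fin.snocEquiv fun _ => W) _ _ fun _ => rfl).symm

/-- Weighted counting of blow-ups of an edge in an `r`-partite `r`-uniform weighted hypergraph. -/
theorem pow_sum_le_sum_blowup {V W : Type*} [Fintype V] [DecidableEq V] [Fintype W] (r : ℕ)
    (μ : Fin r → W → ℝ) (hμ : ∀ j, IsProbWeight (μ j)) (f : (Fin r → W) → ℝ) (hf : ∀ y, 0 ≤ f y) :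
    (∑ y, (∏ j, μ j (y j)) * f y) ^ (Fintype.card V ^ r)
      ≤ ∑ x : Fin r → V → W, (∏ j, ∏ v, μ j (x j v)) *
        ∏ σ : Fin r → V, f fun j => x j (σ j) := by
  induction r with
  | zero => simpa using (congrArg f (Subsingleton.elim _ _)).le
  | succ r ih =>
    set p := Fintype.card V
    have hν := IsProbWeight.pi (I := V) (μ := fun _ => μ 0) fun _ => hμ 0
    have hτ := IsProbWeight.pi (μ := fun j : Fin r => μ j.succ) fun j => hμ j.succ
    let f' : (V → W) → (Fin r → W) → ℝ := fun a y => ∏ v, f (Fin.cons (a v) y)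
    have hf' : ∀ a y, 0 ≤ f' a y := fun a y => prod_nonneg fun v _ => hf _
    -- Jensen over `y` moves the power `p` inside. The `p`-th power of a mean over `a` is a mean
    -- over `p` independent samples `a : V → W`; Jensen over these prepares the induction hypothesis
    -- for `f' a`.
    calc (∑ y, (∏ j, μ j (y j)) * f y) ^ (p ^ (r + 1))
        = ((∑ y : Fin r → W, (∏ j, μ j.succ (y j)) * ∑ a, μ 0 a * f (Fin.cons a y)) ^ p) ^ p ^ r := by
          rw [← pow_mul, pow_succ', sum_fun_fin_succ, sum_comm]
          congr 1
          refine sum_congr rfl fun y _ => ?_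
          rw [mul_sum]
          refine sum_congr rfl fun a _ => ?_
          rw [Fin.prod_univ_succ]
          simp only [Fin.cons_zero, Fin.cons_succ]
          ring
      _ ≤ (∑ y : Fin r → W, (∏ j, μ j.succ (y j)) *
            (∑ a, μ 0 a * f (Fin.cons a y)) ^ p) ^ p ^ r := by
          gcongr
          · exact pow_nonneg (sum_nonneg fun y _ => mul_nonneg (hτ.nonneg y)
              (sum_nonneg fun a _ => mul_nonneg ((hμ 0).nonneg a) (hf _))) _
          · exact hτ.pow_sum_le (fun y =>
              sum_nonneg fun a _ => mul_nonneg ((hμ 0).nonneg a) (hf _)) p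
      _ = (∑ a : V → W, (∏ v, μ 0 (a v)) *
            ∑ y : Fin r → W, (∏ j, μ j.succ (y j)) * f' a y) ^ p ^ r := by
          congr 1
          simp_rw [mul_sum]
          rw [sum_comm]
          refine sum_congr rfl fun y _ => ?_
          rw [show p = #(univ : Finset V) from rfl, ← prod_const, Fintype.prod_sum, mul_sum]
          refine sum_congr rfl fun a _ => ?_
          simp only [f', prod_mul_distrib]
          ring
      _ ≤ ∑ a : V → W, (∏ v, μ 0 (a v)) *
            (∑ y : Fin r → W, (∏ j, μ j.succ (y j)) * f' a y) ^ p ^ r :=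
          hν.pow_sum_le (fun a => sum_nonneg fun y _ => mul_nonneg (hτ.nonneg y) (hf' a y)) _
      _ ≤ ∑ a : V → W, (∏ v, μ 0 (a v)) * ∑ x : Fin r → V → W,
            (∏ j, ∏ v, μ j.succ (x j v)) * ∏ σ : Fin r → V, f' a fun j => x j (σ j) :=
          sum_le_sum fun a _ => mul_le_mul_of_nonneg_left
            (ih (fun j => μ j.succ) (fun j => hμ j.succ) (f' a) (hf' a)) (hν.nonneg a)
      _ = _ := by
          rw [sum_fun_fin_succ]
          refine sum_congr rfl fun a _ => ?_
          rw [mul_sum]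
          refine sum_congr rfl fun x _ => ?_
          have h : ∏ σ : Fin (r + 1) → V, f (fun j => Fin.cons (α := fun _ => V → W) a x j (σ j))
              = ∏ σ : Fin r → V, f' a fun j => x j (σ j) := by
            rw [prod_fun_fin_succ, prod_comm]
            refine prod_congr rfl fun σ _ => prod_congr rfl fun v _ => ?_
            congr 1
            funext j
            refine Fin.cases ?_ (fun j => ?_) j <;> simp
          rw [h, Fin.prod_univ_succ]
          simp only [Fin.cons_zero, Fin.cons_succ, mul_assoc]

/-- Greedy choice of transversal cliques: if, whatever was chosen in earlier parts, all but a
`β`-fraction of each later part is related to each chosen element, there are many cliques. -/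
theorem pow_le_sum_clique {W : Type*} [Fintype W] (r : ℕ)
    (μ : Fin r → W → ℝ) (hμ : ∀ j, IsProbWeight (μ j)) (R : W → W → Prop) [DecidableRel R]
    (β : Fin r → ℝ) {δ : ℝ} (hδ : 0 ≤ δ)
    (hR : ∀ i j, i < j → ∀ a, μ i a ≠ 0 → ∑ b, μ j b * (if R a b then 0 else 1) ≤ β j)
    (hβ : ∀ j, δ ≤ 1 - j * β j) :
    δ ^ r ≤ ∑ y : Fin r → W, (∏ j, μ j (y j)) * (if ∀ i j, i < j → R (y i) (y j) then 1 else 0) := by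
  induction r with
  | zero => simp
  | succ r ih =>
    have key := ih (fun j => μ j.castSucc) (fun j => hμ _) (fun j => β j.castSucc)
      (fun i j hij a ha => hR i.castSucc j.castSucc (by simpa using hij) a ha)
      (fun j => by simpa using hβ j.castSucc)
    have hτ := IsProbWeight.pi (μ := fun j : Fin r => μ j.castSucc) fun j => hμ _
    rw [sum_fun_fin_snoc, pow_succ]
    refine (mul_le_mul_of_nonneg_right key hδ).trans ?_
    rw [sum_mul]
    refine sum_le_sum fun y _ => ?_
    simp only [Fin.prod_univ_castSucc, Fin.snoc_castSucc, Fin.snoc_last]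
    -- The degree condition is available only at points of positive weight.
    by_cases h0 : ∏ j, μ (Fin.castSucc j) (y j) = 0
    · simp [h0]
    have h0' : ∀ j : Fin r, μ j.castSucc (y j) ≠ 0 := fun j hj =>
      h0 (prod_eq_zero (mem_univ j) hj)
    by_cases hy : ∀ i j, i < j → R (y i) (y j)
    swap
    · simp only [hy, if_false, mul_zero, zero_mul]
      exact sum_nonneg fun a _ => mul_nonneg (mul_nonneg (hτ.nonneg y) ((hμ _).nonneg a))
        (by split_ifs <;> norm_num)
    rw [if_pos hy, mul_one]
    simp_rw [mul_assoc, ← mul_sum]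
    refine mul_le_mul_of_nonneg_left ?_ (hτ.nonneg y)
    -- Union bound: `a` fails to extend the clique only if some earlier vertex excludes it.
    have h1 : ∀ a, (1 : ℝ) - ∑ i : Fin r, (if R (y i) a then 0 else 1) ≤
        if ∀ i j, i < j → R (Fin.snoc (α := fun _ => W) y a i) (Fin.snoc (α := fun _ => W) y a j)
          then 1 else 0 := by
      intro a
      split_ifs with h
      · have : (0 : ℝ) ≤ ∑ i : Fin r, (if R (y i) a then 0 else 1) :=
          sum_nonneg fun i _ => by split_ifs <;> norm_num
        linarith
      · have : ∃ i, ¬ R (y i) a := by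
          by_contra! hc
          refine h fun i j hij => ?_
          induction j using Fin.lastCases with
          | last =>
            induction i using Fin.lastCases with
            | last => exact absurd hij (lt_irrefl _)
            | cast i => simpa using hc i
          | cast j =>
            induction i using Fin.lastCases with
            | last => exact absurd hij (not_lt_of_gt (Fin.castSucc_lt_last j))
            | cast i => simpa using hy i j (by simpa using hij)
        obtain ⟨i, hi⟩ := this
        have : (1 : ℝ) ≤ ∑ i : Fin r, (if R (y i) a then 0 else 1) := by
          refine le_trans ?_ (single_le_sum (f := fun i => if R (y i) a then (0 : ℝ) else 1)
            (fun i _ => by split_ifs <;> norm_num) (mem_univ i))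
          simp [hi]
        linarith
    calc δ ≤ 1 - ∑ i : Fin r, β (Fin.last r) := by
          simpa using hβ (Fin.last r)
      _ ≤ 1 - ∑ i : Fin r, ∑ a, μ (Fin.last r) a * (if R (y i) a then 0 else 1) := by
          gcongr with i
          exact hR _ _ (Fin.castSucc_lt_last i) _ (h0' i)
      _ = ∑ a, μ (Fin.last r) a * (1 - ∑ i : Fin r, (if R (y i) a then 0 else 1)) := by
          simp_rw [mul_sub, mul_one, sum_sub_distrib, (hμ _).sum_eq_one, mul_sum]
          rw [sum_comm]
      _ ≤ _ := sum_le_sum fun a _ => mul_le_mul_of_nonneg_left (h1 a) ((hμ _).nonneg a)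

/-! ### Discrepancy and replacement of pseudorandom factors -/

/-- Near-orthogonality of the rows of `D` bounds its discrepancy on weighted rectangles. -/
theorem abs_sum_sum_mul_le_of_orthogonal {W T : Type*} [Fintype W] [DecidableEq T] {μ ν : W → ℝ}
    (hμ : IsProbWeight μ) (hν : IsProbWeight ν) {D : W → W → ℝ} (hD : ∀ a b, |D a b| ≤ 1)
    (t : W → T) {η : ℝ} (hη : 0 ≤ η)
    (hort : ∀ a a', t a ≠ t a' → ∑ b, ν b * (D a b * D a' b) = 0)
    (ht : ∀ s, ∑ a, μ a * (if t a = s then 1 else 0) ≤ η ^ 2)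
    {φ ψ : W → ℝ} (hφ : ∀ a, 0 ≤ φ a ∧ φ a ≤ 1) (hψ : ∀ a, 0 ≤ ψ a ∧ ψ a ≤ 1) :
    |∑ a, ∑ b, μ a * ν b * (φ a * ψ b * D a b)| ≤ η := by
  refine abs_le_of_sq_le_sq ?_ hη
  set T' : W → ℝ := fun b => ∑ a, μ a * φ a * D a b with hT
  have h1 : ∑ a, ∑ b, μ a * ν b * (φ a * ψ b * D a b) = ∑ b, ν b * (ψ b * T' b) := by
    rw [sum_comm]
    refine sum_congr rfl fun b _ => ?_
    simp only [hT, mul_sum]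
    exact sum_congr rfl fun a _ => by ring
  rw [h1]
  have hrow : ∀ a a', ∑ b, ν b * (D a b * D a' b) ≤ if t a' = t a then 1 else 0 := by
    intro a a'
    split_ifs with h
    · refine hν.sum_mul_le fun b => (le_abs_self _).trans ?_
      rw [abs_mul]
      exact mul_le_one₀ (hD _ _) (abs_nonneg _) (hD _ _)
    · exact (hort a a' (Ne.symm h)).le
  -- Jensen for the square removes `ψ`. Expanding the square then leaves only pairs of rows with
  -- equal type, of weight at most `η ^ 2`.
  calc (∑ b, ν b * (ψ b * T' b)) ^ 2 ≤ ∑ b, ν b * (ψ b * T' b) ^ 2 :=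
        Real.pow_arith_mean_le_arith_mean_pow_of_even _ _ _ (fun b _ => hν.nonneg b)
          hν.sum_eq_one even_two
    _ ≤ ∑ b, ν b * (T' b) ^ 2 := by
        refine sum_le_sum fun b _ => mul_le_mul_of_nonneg_left ?_ (hν.nonneg b)
        rw [mul_pow]
        exact mul_le_of_le_one_left (sq_nonneg _) (pow_le_one₀ (hψ b).1 (hψ b).2)
    _ = ∑ a, μ a * (φ a * ∑ a', μ a' * (φ a' * ∑ b, ν b * (D a b * D a' b))) := by
        simp_rw [sq, hT, sum_mul_sum, mul_sum]
        rw [sum_comm]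
        refine sum_congr rfl fun a _ => ?_
        rw [sum_comm]
        exact sum_congr rfl fun a' _ => sum_congr rfl fun b _ => by ring
    _ ≤ η ^ 2 := by
        refine hμ.sum_mul_le fun a => ?_
        have h2 : ∑ a', μ a' * (φ a' * ∑ b, ν b * (D a b * D a' b)) ≤ η ^ 2 := by
          refine le_trans (sum_le_sum fun a' _ => ?_) (ht (t a))
          refine mul_le_mul_of_nonneg_left ?_ (hμ.nonneg a')
          refine (mul_le_mul_of_nonneg_left (hrow a a') (hφ a').1).trans ?_
          exact mul_le_of_le_one_left (by split_ifs <;> norm_num) (hφ a').2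
        exact (mul_le_mul_of_nonneg_left h2 (hφ a).1).trans
          (mul_le_of_le_one_left (sq_nonneg _) (hφ a).2)

section Replacement

variable {I W : Type*}

/-- The product of `k (x u) (x v)` over the pairs `(u, v)` in `P`. -/
def pairProd (P : Finset (I × I)) (k : W → W → ℝ) (x : I → W) : ℝ :=
  ∏ e ∈ P, k (x e.1) (x e.2)

theorem pairProd_mem_unit {k : W → W → ℝ} (hk : ∀ a b, 0 ≤ k a b ∧ k a b ≤ 1)
    (P : Finset (I × I)) (x : I → W) : 0 ≤ pairProd P k x ∧ pairProd P k x ≤ 1 :=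
  ⟨prod_nonneg fun _ _ => (hk _ _).1, prod_le_one (fun _ _ => (hk _ _).1) fun _ _ => (hk _ _).2⟩

theorem pairProd_update [DecidableEq I] (P : Finset (I × I)) (k : W → W → ℝ) (x : I → W) (v : I)
    (b : W) (hP : ∀ e ∈ P, e.1 ≠ v ∧ e.2 ≠ v) :
    pairProd P k (Function.update x v b) = pairProd P k x :=
  prod_congr rfl fun e he => by
    rw [Function.update_of_ne (hP e he).1, Function.update_of_ne (hP e he).2]

theorem mul_mem_unit {a b : ℝ} (ha : 0 ≤ a ∧ a ≤ 1) (hb : 0 ≤ b ∧ b ≤ 1) :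
    0 ≤ a * b ∧ a * b ≤ 1 :=
  ⟨mul_nonneg ha.1 hb.1, mul_le_one₀ ha.2 hb.1 hb.2⟩

variable [Fintype W] [Fintype I] [DecidableEq I]

/-- With all coordinates except `u` and `v` frozen, `Φ` depends only on `x u` and `Ψ` only on `x v`,
so `hD` applies; then average over the frozen coordinates. -/
theorem abs_sum_discrepancy_le {μ : I → W → ℝ} (hμ : ∀ i, IsProbWeight (μ i)) {u v : I}
    (huv : u ≠ v) {D : W → W → ℝ} {η : ℝ}
    (hD : ∀ φ ψ : W → ℝ, (∀ a, 0 ≤ φ a ∧ φ a ≤ 1) → (∀ a, 0 ≤ ψ a ∧ ψ a ≤ 1) →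
      |∑ a, ∑ b, μ u a * μ v b * (φ a * ψ b * D a b)| ≤ η)
    {Φ Ψ : (I → W) → ℝ} (hΦ : ∀ x, 0 ≤ Φ x ∧ Φ x ≤ 1) (hΨ : ∀ x, 0 ≤ Ψ x ∧ Ψ x ≤ 1)
    (hΦv : ∀ x b, Φ (Function.update x v b) = Φ x)
    (hΨu : ∀ x a, Ψ (Function.update x u a) = Ψ x) :
    |∑ x : I → W, (∏ i, μ i (x i)) * (Φ x * Ψ x * D (x u) (x v))| ≤ η := by
  rw [IsProbWeight.sum_pi_update_update hμ u v]
  refine (IsProbWeight.pi hμ).abs_sum_mul_le fun x => ?_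
  convert hD (fun a => Φ (Function.update x u a)) (fun b => Ψ (Function.update x v b))
    (fun a => hΦ _) (fun b => hΨ _) using 6 with a _ b _
  · rw [hΦv, Function.update_comm huv, hΨu]
  · rw [Function.update_of_ne huv, Function.update_self, Function.update_self]

/-- Replacing pseudorandom factors by their density in a weighted count. -/
theorem pow_mul_sum_le_sum_add {K : Type*} [Preorder K] (c : I → K)
    {μ : I → W → ℝ} (hμ : ∀ i, IsProbWeight (μ i)) {k g : W → W → ℝ}
    (hk : ∀ a b, 0 ≤ k a b ∧ k a b ≤ 1) (hg : ∀ a b, 0 ≤ g a b ∧ g a b ≤ 1)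
    {ε η : ℝ} (hε : 0 ≤ ε) (hε1 : ε ≤ 1) (hη : 0 ≤ η)
    (hD : ∀ u v, c u < c v → ∀ φ ψ : W → ℝ, (∀ a, 0 ≤ φ a ∧ φ a ≤ 1) →
      (∀ a, 0 ≤ ψ a ∧ ψ a ≤ 1) →
      |∑ a, ∑ b, μ u a * μ v b * (φ a * ψ b * (g a b - ε))| ≤ η)
    (E N : Finset (I × I)) (hE : ∀ e ∈ E, c e.1 < c e.2) (hN : ∀ e ∈ N, c e.1 < c e.2)
    (hEN : Disjoint E N) :
    ε ^ #N * ∑ x : I → W, (∏ i, μ i (x i)) * pairProd E k x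
      ≤ ∑ x : I → W, (∏ i, μ i (x i)) * (pairProd E k x * pairProd N g x) + #N * η := by
  induction N using Finset.induction_on with
  | empty => simp [pairProd]
  | insert e N heN ih =>
    obtain ⟨u, v⟩ := e
    have huv : c u < c v := hN _ (mem_insert_self _ _)
    have hne : u ≠ v := fun h => huv.ne (congrArg c h)
    have key := ih (fun e he => hN e (mem_insert_of_mem he))
      (hEN.mono_right (subset_insert _ _))
    have hsplit : ∀ (P : Finset (I × I)) (k : W → W → ℝ) (x : I → W),
        pairProd P k x = pairProd (P.filter fun e => e.1 ≠ v ∧ e.2 ≠ v) k x *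
          pairProd (P.filter fun e => ¬ (e.1 ≠ v ∧ e.2 ≠ v)) k x := fun P k x =>
      (prod_filter_mul_prod_filter_not _ _ _).symm
    -- A pair touching both `u` and `v` could only be `(u, v)`, which is not in `P`, or `(v, u)`,
    -- which has the wrong orientation. So the factors involving `v` do not involve `u`.
    have hout : ∀ P : Finset (I × I), (∀ e ∈ P, c e.1 < c e.2) → (u, v) ∉ P →
        ∀ e ∈ P.filter fun e => ¬ (e.1 ≠ v ∧ e.2 ≠ v), e.1 ≠ u ∧ e.2 ≠ u := by
      rintro P hP huP ⟨a, b⟩ he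
      rw [mem_filter] at he
      have hab : c a < c b := hP _ he.1
      simp only
      by_contra hcon
      by_cases ha : a = v
      · subst ha
        by_cases hb : b = u
        · subst hb
          exact lt_asymm hab huv
        · exact hcon ⟨hne.symm, hb⟩
      · have hb : b = v := by
          by_contra hb
          exact he.2 ⟨ha, hb⟩
        subst hb
        by_cases ha' : a = u
        · subst ha'
          exact huP he.1
        · exact hcon ⟨ha', hne.symm⟩
    have huE : (u, v) ∉ E := fun h => disjoint_left.mp hEN h (mem_insert_self _ _)
    have hdisc := abs_sum_discrepancy_le hμ hne (hD u v huv)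
      (Φ := fun x => pairProd (E.filter fun e => e.1 ≠ v ∧ e.2 ≠ v) k x *
        pairProd (N.filter fun e => e.1 ≠ v ∧ e.2 ≠ v) g x)
      (Ψ := fun x => pairProd (E.filter fun e => ¬ (e.1 ≠ v ∧ e.2 ≠ v)) k x *
        pairProd (N.filter fun e => ¬ (e.1 ≠ v ∧ e.2 ≠ v)) g x)
      (fun x => mul_mem_unit (pairProd_mem_unit hk _ x) (pairProd_mem_unit hg _ x))
      (fun x => mul_mem_unit (pairProd_mem_unit hk _ x) (pairProd_mem_unit hg _ x))
      (fun x b => by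
        rw [pairProd_update _ _ _ _ _ fun e he => (mem_filter.mp he).2,
          pairProd_update _ _ _ _ _ fun e he => (mem_filter.mp he).2])
      (fun x a => by
        rw [pairProd_update _ _ _ _ _ (hout E hE huE),
          pairProd_update _ _ _ _ _
            (hout N (fun e he => hN e (mem_insert_of_mem he)) heN)])
    have hsum : ∑ x : I → W, (∏ i, μ i (x i)) *
          (pairProd E k x * pairProd (insert (u, v) N) g x)
        = ε * ∑ x : I → W, (∏ i, μ i (x i)) * (pairProd E k x * pairProd N g x)
          + ∑ x : I → W, (∏ i, μ i (x i)) *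
            (pairProd (E.filter fun e => e.1 ≠ v ∧ e.2 ≠ v) k x *
              pairProd (N.filter fun e => e.1 ≠ v ∧ e.2 ≠ v) g x *
            (pairProd (E.filter fun e => ¬ (e.1 ≠ v ∧ e.2 ≠ v)) k x *
              pairProd (N.filter fun e => ¬ (e.1 ≠ v ∧ e.2 ≠ v)) g x) *
            (g (x u) (x v) - ε)) := by
      rw [mul_sum, ← sum_add_distrib]
      refine sum_congr rfl fun x _ => ?_
      have : pairProd (insert (u, v) N) g x = g (x u) (x v) * pairProd N g x :=
        prod_insert heN
      rw [this, hsplit E k x, hsplit N g x]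
      ring
    rw [hsum, card_insert_of_notMem heN, pow_succ']
    have h1 := (abs_le.mp hdisc).1
    have h2 := mul_le_mul_of_nonneg_left key hε
    -- Earlier errors are multiplied by `ε ≤ 1`, so the errors only add up.
    have h3 : ε * (#N * η) ≤ #N * η := mul_le_of_le_one_left (mul_nonneg (Nat.cast_nonneg _) hη) hε1
    push_cast
    nlinarith

end Replacement

/-! ### Finding a prescribed pattern -/

/-- In a weighted `r`-partite structure with many transversal `R`-cliques and a pseudorandom
relation `Q` of density `ε`, every prescribed pattern of `R` and `Q` occurs between the parts. -/
theorem exists_injective_pattern {V W : Type*} [Fintype V] [Fintype W] {r : ℕ}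
    (A : V → V → Prop) {μ : Fin r → W → ℝ} (hμ : ∀ j, IsProbWeight (μ j)) (R Q : W → W → Prop)
    [DecidableRel R] [DecidableRel Q] {ε η κ : ℝ} (hε : 0 ≤ ε) (hε1 : ε ≤ 1) (hη : 0 ≤ η)
    (hκ : 0 ≤ κ)
    (hclique : κ ≤ ∑ y : Fin r → W, (∏ j, μ j (y j)) *
      (if ∀ i j, i < j → R (y i) (y j) then 1 else 0))
    (hdisc : ∀ i j, i < j → ∀ φ ψ : W → ℝ, (∀ a, 0 ≤ φ a ∧ φ a ≤ 1) →
      (∀ a, 0 ≤ ψ a ∧ ψ a ≤ 1) →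
      |∑ a, ∑ b, μ i a * μ j b * (φ a * ψ b * ((if Q a b then 1 else 0) - ε))| ≤ η)
    (hpoint : ∀ j w, μ j w ≤ η)
    (hsmall : 2 * ((r * Fintype.card V) ^ 2 * η)
      < ε ^ ((r * Fintype.card V) ^ 2) * κ ^ (Fintype.card V ^ r)) :
    ∃ x : Fin r × V → W, Function.Injective x ∧ (∀ u, μ u.1 (x u) ≠ 0) ∧
      (∀ u v, u.1 < v.1 → A u.2 v.2 → R (x u) (x v)) ∧
      (∀ u v, u.1 < v.1 → ¬ A u.2 v.2 → Q (x u) (x v)) := by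
  classical
  by_contra! hcon
  set p := Fintype.card V
  let ν : Fin r × V → W → ℝ := fun u => μ u.1
  have hν : ∀ u, IsProbWeight (ν u) := fun u => hμ u.1
  let k : W → W → ℝ := fun a b => if R a b then 1 else 0
  let g : W → W → ℝ := fun a b => if Q a b then 1 else 0
  have hk : ∀ a b, 0 ≤ k a b ∧ k a b ≤ 1 := fun a b => by
    simp only [k]; split_ifs <;> norm_num
  have hg : ∀ a b, 0 ≤ g a b ∧ g a b ≤ 1 := fun a b => by
    simp only [g]; split_ifs <;> norm_num
  let E : Finset ((Fin r × V) × (Fin r × V)) :=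
    univ.filter fun e => e.1.1 < e.2.1 ∧ A e.1.2 e.2.2
  let N : Finset ((Fin r × V) × (Fin r × V)) :=
    univ.filter fun e => e.1.1 < e.2.1 ∧ ¬ A e.1.2 e.2.2
  have hcard : Fintype.card ((Fin r × V) × (Fin r × V)) = (r * p) ^ 2 := by
    simp [p, sq]
  have hNcard : #N ≤ (r * p) ^ 2 := (card_le_univ N).trans hcard.le
  have hrep := pow_mul_sum_le_sum_add (fun u : Fin r × V => u.1) hν hk hg hε hε1 hη
    (fun u v huv => hdisc u.1 v.1 huv) E N (fun e he => (mem_filter.mp he).2.1)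
    (fun e he => (mem_filter.mp he).2.1)
    (disjoint_left.mpr fun e he he' => (mem_filter.mp he').2.2 (mem_filter.mp he).2.2)
  have hblow : κ ^ (p ^ r) ≤ ∑ x : Fin r × V → W, (∏ i, ν i (x i)) * pairProd E k x := by
    refine (pow_le_pow_left₀ hκ hclique _).trans ?_
    refine (pow_sum_le_sum_blowup (V := V) r μ hμ _ fun y => by split_ifs <;> norm_num).trans ?_
    rw [← Fintype.sum_equiv (Equiv.curry (Fin r) V W) (fun x =>
      (∏ j, ∏ v, μ j (x (j, v))) * ∏ σ : Fin r → V,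
        (if ∀ i j, i < j → R (x (i, σ i)) (x (j, σ j)) then (1 : ℝ) else 0)) _ fun x => rfl]
    refine sum_le_sum fun x _ => ?_
    rw [Fintype.prod_prod_type]
    refine mul_le_mul_of_nonneg_left ?_
      (prod_nonneg fun j _ => prod_nonneg fun v _ => (hμ j).nonneg _)
    by_cases hall : ∀ σ : Fin r → V, ∀ i j, i < j → R (x (i, σ i)) (x (j, σ j))
    · refine (prod_le_one (fun σ _ => by split_ifs <;> norm_num)
        fun σ _ => by split_ifs <;> norm_num).trans ?_
      refine le_of_eq (prod_eq_one ?_).symm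
      rintro ⟨⟨i, a⟩, ⟨j, b⟩⟩ he
      have hij : i < j := (mem_filter.mp he).2.1
      -- Any two vertices in different parts lie on a common transversal `σ`.
      have := hall (Function.update (fun _ => a) j b) i j hij
      rw [Function.update_self, Function.update_of_ne hij.ne] at this
      simp [k, this]
    · push Not at hall
      obtain ⟨σ, i, j, hij, hR⟩ := hall
      rw [prod_eq_zero (mem_univ σ) (if_neg fun h => hR (h i j hij))]
      exact (pairProd_mem_unit hk _ _).1
  have hcoll : ∑ x : Fin r × V → W, (∏ i, ν i (x i)) * (pairProd E k x * pairProd N g x)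
      ≤ (r * p) ^ 2 * η := by
    -- By `hcon` only noninjective `x` contribute, and these are bounded by a sum over colliding
    -- pairs.
    calc _ ≤ ∑ x : Fin r × V → W, (∏ i, ν i (x i)) *
          ∑ e : (Fin r × V) × (Fin r × V), (if e.1 ≠ e.2 ∧ x e.1 = x e.2 then (1 : ℝ) else 0) := by
          refine sum_le_sum fun x _ => ?_
          by_cases h0 : ∏ i, ν i (x i) = 0
          · simp [h0]
          refine mul_le_mul_of_nonneg_left ?_ ((IsProbWeight.pi hν).nonneg x)
          by_cases hinj : Function.Injective x
          · by_cases hE : ∀ u v, u.1 < v.1 → A u.2 v.2 → R (x u) (x v)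
            · obtain ⟨u, v, huv, hA, hQ⟩ := hcon x hinj
                (fun u h => h0 (prod_eq_zero (mem_univ u) h)) hE
              have : pairProd N g x = 0 :=
                prod_eq_zero (i := (u, v)) (by simp [N, huv, hA]) (by simp [g, hQ])
              simp [this]
            · push Not at hE
              obtain ⟨u, v, huv, hA, hR⟩ := hE
              have : pairProd E k x = 0 :=
                prod_eq_zero (i := (u, v)) (by simp [E, huv, hA]) (by simp [k, hR])
              simp [this]
          · rw [Function.Injective] at hinj
            push Not at hinj
            obtain ⟨u, v, hx, huv⟩ := hinj
            refine (mul_mem_unit (pairProd_mem_unit hk _ _) (pairProd_mem_unit hg _ _)).2.trans ?_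
            refine le_trans ?_ (single_le_sum (f := fun e : (Fin r × V) × (Fin r × V) =>
              if e.1 ≠ e.2 ∧ x e.1 = x e.2 then (1 : ℝ) else 0)
              (fun e _ => by split_ifs <;> norm_num) (mem_univ (u, v)))
            simp [hx, huv]
      _ = ∑ e : (Fin r × V) × (Fin r × V), ∑ x : Fin r × V → W, (∏ i, ν i (x i)) *
            (if e.1 ≠ e.2 ∧ x e.1 = x e.2 then (1 : ℝ) else 0) := by
          simp_rw [mul_sum]
          exact sum_comm
      _ ≤ ∑ e : (Fin r × V) × (Fin r × V), η := by
          refine sum_le_sum fun e _ => ?_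
          by_cases he : e.1 = e.2
          · simpa [he] using hη
          -- Once one of two independent samples is fixed, the other equals it with probability at
          -- most `η`.
          rw [IsProbWeight.sum_pi_update_update hν e.1 e.2]
          refine (IsProbWeight.pi hν).sum_mul_le fun x => ?_
          simp only [Function.update_self, Function.update_of_ne he, ne_eq, he, not_false_eq_true,
            true_and, mul_ite, mul_one, mul_zero, sum_ite_eq, mem_univ, if_true]
          exact (hν e.1).sum_mul_le fun a => hpoint _ _
      _ = (r * p) ^ 2 * η := by
          rw [sum_const, card_univ, hcard, nsmul_eq_mul]
          push_cast
          rfl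
  have h1 : ε ^ ((r * p) ^ 2) * κ ^ (p ^ r)
      ≤ ε ^ #N * ∑ x : Fin r × V → W, (∏ i, ν i (x i)) * pairProd E k x :=
    mul_le_mul (pow_le_pow_of_le_one hε hε1 hNcard) hblow (by positivity) (by positivity)
  have h2 : (#N : ℝ) * η ≤ (r * p) ^ 2 * η := by
    refine mul_le_mul_of_nonneg_right ?_ hη
    exact_mod_cast hNcard
  -- The factor 2 in `hsmall` pays for two errors, from replacement and from collisions.
  linarith

/-! ### The code graph and its pseudorandom holes -/

/-- If `d` has mean zero then so has the product of `d (h s)` with a function of the other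
coordinates of `h`. -/
theorem sum_eval_mul_eq_zero {ι A : Type*} [Fintype ι] [DecidableEq ι] [Fintype A] [Nonempty A]
    {d : A → ℝ} (hd : ∑ z, d z = 0) (s : ι) (G : (ι → A) → ℝ)
    (hG : ∀ h z, G (Function.update h s z) = G h) : ∑ h : ι → A, d (h s) * G h = 0 := by
  have hA : (Fintype.card A : ℝ) ≠ 0 := by simp
  have hμ : IsProbWeight fun _ : A => (Fintype.card A : ℝ)⁻¹ :=
    ⟨fun _ => by positivity, by simp [hA]⟩
  have key := IsProbWeight.sum_pi_update (I := ι) (fun _ => hμ) s fun h => d (h s) * G h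
  have h0 : ∀ h : ι → A, ∑ z, (Fintype.card A : ℝ)⁻¹ *
      (d (Function.update h s z s) * G (Function.update h s z)) = 0 := fun h => by
    simp_rw [hG, Function.update_self]
    rw [← mul_sum, ← sum_mul, hd, zero_mul, mul_zero]
  simp only [h0, mul_zero, sum_const_zero, prod_const] at key
  rw [← mul_sum] at key
  exact (mul_eq_zero.mp key).resolve_left (pow_ne_zero _ (inv_ne_zero hA))

/-- Vertices of the code graph: a part `j`, a coordinate, a word over `Fin (q + 1)`, and one of
`M j` copies. -/
abbrev CodeVertex {r : ℕ} (m q : ℕ) (M : Fin r → ℕ) : Type :=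
  Σ j : Fin r, (Fin m × (Fin m → Fin (q + 1))) × Fin (M j)

section CodeGraph

variable {r m q : ℕ} {M : Fin r → ℕ}

/-- The coordinate of `a` is a zero of the word of `b`. -/
def IsHole (a b : CodeVertex m q M) : Prop := b.2.1.2 a.2.1.1 = 0

instance : DecidableRel (IsHole (m := m) (q := q) (M := M)) := fun _ _ =>
  inferInstanceAs (Decidable (_ = _))

/-- The multipartite graph whose nonedges between different parts are the holes. -/
def codeGraph (m q : ℕ) (M : Fin r → ℕ) : SimpleGraph (CodeVertex m q M) where
  Adj a b := a.1 < b.1 ∧ ¬ IsHole a b ∨ b.1 < a.1 ∧ ¬ IsHole b a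
  symm := ⟨fun _ _ h => h.symm⟩
  loopless := ⟨fun a h => by simp at h⟩

theorem codeGraph_adj_of_lt {a b : CodeVertex m q M} (h : a.1 < b.1) :
    (codeGraph m q M).Adj a b ↔ ¬ IsHole a b := by
  simp [codeGraph, h, h.not_gt]

theorem codeGraph_not_adj_of_eq {a b : CodeVertex m q M} (h : a.1 = b.1) :
    ¬ (codeGraph m q M).Adj a b := by
  simp [codeGraph, h]

/-- The size of a part of the code graph. -/
def partSize (m q : ℕ) (M : Fin r → ℕ) (j : Fin r) : ℕ := m * (q + 1) ^ m * M j

/-- The uniform probability weight on a part of the code graph. -/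
noncomputable def uniformPart (m q : ℕ) (M : Fin r → ℕ) (j : Fin r) (w : CodeVertex m q M) : ℝ :=
  if w.1 = j then (partSize m q M j : ℝ)⁻¹ else 0

theorem sum_uniformPart_mul (j : Fin r) (F : CodeVertex m q M → ℝ) :
    ∑ w, uniformPart m q M j w * F w = (partSize m q M j : ℝ)⁻¹ * ∑ z, F ⟨j, z⟩ := by
  rw [Fintype.sum_sigma, Fintype.sum_eq_single j]
  · simp [uniformPart, mul_sum]
  · intro i hi
    simp [uniformPart, hi]

theorem card_part (j : Fin r) :
    Fintype.card ((Fin m × (Fin m → Fin (q + 1))) × Fin (M j)) = partSize m q M j := by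
  simp [partSize]

theorem partSize_ne_zero (hm : m ≠ 0) (hM : ∀ j, M j ≠ 0) (j : Fin r) :
    (partSize m q M j : ℝ) ≠ 0 := by
  have := hM j
  simp only [partSize]
  positivity

theorem isProbWeight_uniformPart (hm : m ≠ 0) (hM : ∀ j, M j ≠ 0) (j : Fin r) :
    IsProbWeight (uniformPart m q M j) where
  nonneg w := by
    unfold uniformPart
    split_ifs <;> positivity
  sum_eq_one := by
    have := sum_uniformPart_mul (m := m) (q := q) (M := M) j fun _ => 1
    simp only [mul_one, sum_const, card_univ, card_part, nsmul_eq_mul] at this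
    rw [this, inv_mul_cancel₀ (partSize_ne_zero hm hM j)]

/-- The centred indicator of the letter zero. -/
noncomputable def zeroDefect (q : ℕ) (z : Fin (q + 1)) : ℝ := (if z = 0 then 1 else 0) - 1 / (q + 1)

theorem sum_zeroDefect (q : ℕ) : ∑ z, zeroDefect q z = 0 := by
  have : (q : ℝ) + 1 ≠ 0 := by positivity
  simp [zeroDefect, this]

theorem abs_zeroDefect_le (q : ℕ) (z : Fin (q + 1)) : |zeroDefect q z| ≤ 1 := by
  have h0 : (0 : ℝ) ≤ 1 / (q + 1) := by positivity
  have h1 : (1 : ℝ) / (q + 1) ≤ 1 := by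
    rw [div_le_one (by positivity)]
    linarith [(Nat.cast_nonneg q : (0 : ℝ) ≤ q)]
  unfold zeroDefect
  split_ifs <;> rw [abs_le] <;> constructor <;> linarith

theorem sum_uniformPart_mul_word (j : Fin r) (G : (Fin m → Fin (q + 1)) → ℝ)
    (hG : ∑ h, G h = 0) : ∑ w, uniformPart m q M j w * G w.2.1.2 = 0 := by
  rw [sum_uniformPart_mul, Fintype.sum_prod_type, Fintype.sum_prod_type]
  simp [← mul_sum, hG]

theorem sum_uniformPart_hole (hm : m ≠ 0) (hM : ∀ j, M j ≠ 0) (j : Fin r) (a : CodeVertex m q M) :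
    ∑ b, uniformPart m q M j b * (if IsHole a b then 1 else 0) = 1 / (q + 1 : ℝ) := by
  have h := sum_uniformPart_mul_word (M := M) j (fun h => zeroDefect q (h a.2.1.1))
    (by simpa using sum_eval_mul_eq_zero (sum_zeroDefect q) a.2.1.1 (fun _ => 1) fun _ _ => rfl)
  simp only [zeroDefect, mul_sub, sum_sub_distrib, ← sum_mul,
    (isProbWeight_uniformPart hm hM j).sum_eq_one, one_mul] at h
  exact sub_eq_zero.mp h

theorem sum_uniformPart_coordinate (hm : m ≠ 0) (hM : ∀ j, M j ≠ 0) (j : Fin r) (s : Fin m) :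
    ∑ a, uniformPart m q M j a * (if a.2.1.1 = s then 1 else 0) = 1 / (m : ℝ) := by
  have hj : (M j : ℝ) ≠ 0 := Nat.cast_ne_zero.mpr (hM j)
  have h : (m : ℝ) ≠ 0 := by positivity
  rw [sum_uniformPart_mul, Fintype.sum_prod_type, Fintype.sum_prod_type]
  simp only [partSize, Nat.cast_mul, Nat.cast_pow, Nat.cast_add, Nat.cast_one]
  have h1 : ∑ s' : Fin m, ∑ _h : Fin m → Fin (q + 1), ∑ _k : Fin (M j),
      (if s' = s then (1 : ℝ) else 0) = (q + 1) ^ m * M j := by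
    simp
  rw [h1]
  field_simp

theorem uniformPart_le (hm : m ≠ 0) (hM : ∀ j, M j ≠ 0) (j : Fin r) (w : CodeVertex m q M) :
    uniformPart m q M j w ≤ 1 / m := by
  unfold uniformPart
  split_ifs
  · rw [← one_div]
    refine one_div_le_one_div_of_le (by positivity) ?_
    have h : 1 ≤ (q + 1) ^ m * M j := Nat.mul_pos (by positivity) (Nat.pos_of_ne_zero (hM j))
    have h2 : m ≤ partSize m q M j := by
      rw [partSize, mul_assoc]
      exact Nat.le_mul_of_pos_right m h
    exact_mod_cast h2
  · positivity

/-- Letters of a uniform word at distinct coordinates are independent, so the centred hole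
indicators of vertices with distinct coordinates are orthogonal. A given coordinate has weight only
`1 / m`. -/
theorem abs_hole_discrepancy_le (hm : m ≠ 0) (hM : ∀ j, M j ≠ 0) {η : ℝ} (hη : 0 ≤ η)
    (hmη : 1 / (m : ℝ) ≤ η ^ 2) (i j : Fin r) {φ ψ : CodeVertex m q M → ℝ}
    (hφ : ∀ a, 0 ≤ φ a ∧ φ a ≤ 1) (hψ : ∀ a, 0 ≤ ψ a ∧ ψ a ≤ 1) :
    |∑ a, ∑ b, uniformPart m q M i a * uniformPart m q M j b *
      (φ a * ψ b * ((if IsHole a b then 1 else 0) - 1 / (q + 1 : ℝ)))| ≤ η := by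
  refine abs_sum_sum_mul_le_of_orthogonal (isProbWeight_uniformPart hm hM i)
    (isProbWeight_uniformPart hm hM j) (D := fun a b => zeroDefect q (b.2.1.2 a.2.1.1))
    (fun a b => abs_zeroDefect_le _ _) (fun a => a.2.1.1) hη (fun a a' h => ?_)
    (fun s => (sum_uniformPart_coordinate hm hM i s).trans_le hmη) hφ hψ
  refine sum_uniformPart_mul_word j
    (fun h => zeroDefect q (h a.2.1.1) * zeroDefect q (h a'.2.1.1)) ?_
  exact sum_eval_mul_eq_zero (sum_zeroDefect q) _ _ fun h z => by
    rw [Function.update_of_ne (Ne.symm ‹_›)]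

/-! ### Colourings of the code graph -/

/-- Without a blue induced star, blue degrees into parts are small. -/
theorem card_blue_lt {n : ℕ} (c : (codeGraph m q M).EdgeLabeling Bool)
    (hstar : ¬ HasMonoInducedCopy (codeGraph m q M) c false (starK n)) {a : CodeVertex m q M}
    {j : Fin r} (haj : a.1 ≠ j) :
    Nat.card {z // (c.labelGraph false).Adj a ⟨j, z⟩} < n := by
  by_contra! hn
  refine hstar ?_
  classical
  obtain ⟨e⟩ : Nonempty (Fin n ↪ {z // (c.labelGraph false).Adj a ⟨j, z⟩}) := by
    apply Function.Embedding.nonempty_of_card_le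
    simpa [Nat.card_eq_fintype_card] using hn
  have hblue : ∀ k, ∃ h : (codeGraph m q M).Adj a ⟨j, (e k).1⟩, c.get a ⟨j, (e k).1⟩ h = false :=
    fun k => (SimpleGraph.EdgeLabeling.labelGraph_adj _ _).mp (e k).2
  -- All leaves lie in the single part `j`, which is independent, so the star is induced.
  let f : Fin 1 ⊕ Fin n → CodeVertex m q M := Sum.elim (fun _ => a) fun k => ⟨j, (e k).1⟩
  have hinj : Function.Injective f := by
    rintro (x | x) (y | y) h
    · rw [Subsingleton.elim x y]
    · exact absurd (congrArg Sigma.fst h) haj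
    · exact absurd (congrArg Sigma.fst h).symm haj
    · simpa [f, Subtype.val_inj] using h
  refine ⟨⟨⟨f, hinj⟩, fun {x y} => ?_⟩, ?_⟩
  · rcases x with x | x <;> rcases y with y | y
    · simp [f]
    · simpa [f] using (hblue y).1
    · simpa [f] using (hblue x).1.symm
    · exact iff_of_false (codeGraph_not_adj_of_eq rfl) (by simp)
  · rintro (x | x) (y | y) h
    · simp at h
    · exact (hblue y).2
    · exact (c.get_comm _ _ _).trans (hblue x).2
    · simp at h

/-- A pair in different parts that is not red is blue or a hole: the first term bounds the blue
pairs, the second is the exact density of holes. -/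
theorem sum_uniformPart_not_red_le {n : ℕ} (hm : m ≠ 0) (hM : ∀ j, M j ≠ 0)
    (c : (codeGraph m q M).EdgeLabeling Bool) [DecidableRel (c.labelGraph true).Adj]
    (hstar : ¬ HasMonoInducedCopy (codeGraph m q M) c false (starK n)) {a : CodeVertex m q M}
    {j : Fin r} (haj : a.1 < j) :
    ∑ b, uniformPart m q M j b * (if (c.labelGraph true).Adj a b then 0 else 1)
      ≤ n / partSize m q M j + 1 / (q + 1 : ℝ) := by
  classical
  rw [← sum_uniformPart_hole hm hM j a]
  have hblue : ∑ b, uniformPart m q M j b * (if (c.labelGraph false).Adj a b then 1 else 0)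
      ≤ (n : ℝ) / partSize m q M j := by
    rw [sum_uniformPart_mul, div_eq_inv_mul]
    refine mul_le_mul_of_nonneg_left ?_ (by positivity)
    have := card_blue_lt c hstar haj.ne
    rw [Nat.card_eq_fintype_card, Fintype.card_subtype] at this
    rw [sum_boole]
    exact_mod_cast this.le
  refine le_trans ?_ (add_le_add_left hblue _)
  rw [← sum_add_distrib]
  refine sum_le_sum fun b _ => ?_
  by_cases hb : b.1 = j
  · rw [← mul_add]
    refine mul_le_mul_of_nonneg_left ?_ ((isProbWeight_uniformPart hm hM j).nonneg b)
    by_cases hh : IsHole a b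
    · simp only [hh, if_true]
      split_ifs <;> norm_num
    · have hadj : (codeGraph m q M).Adj a b := (codeGraph_adj_of_lt (hb ▸ haj)).mpr hh
      cases hc : c.get a b hadj with
      | true =>
        have : (c.labelGraph true).Adj a b :=
          (SimpleGraph.EdgeLabeling.labelGraph_adj _ _).mpr ⟨hadj, hc⟩
        simp only [this, if_true]
        split_ifs <;> norm_num
      | false =>
        have : (c.labelGraph false).Adj a b :=
          (SimpleGraph.EdgeLabeling.labelGraph_adj _ _).mpr ⟨hadj, hc⟩
        simp only [this, if_true]
        split_ifs <;> norm_num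
  · simp [uniformPart, hb]

/-- The pattern lemma supplies a copy of `V` in every part. Keeping `v` only in part `C v` suffices,
since colour classes of `H` and parts of the graph are both independent. -/
theorem codeGraph_inducedArrows {V : Type*} [Fintype V] {H : SimpleGraph V}
    (C : H.Coloring (Fin r)) {n : ℕ} (hm : m ≠ 0) (hM : ∀ j, M j ≠ 0) {η δ : ℝ} (hη : 0 ≤ η)
    (hη1 : η ≤ 1) (hmη : 1 / (m : ℝ) ≤ η ^ 2) (hδ : 0 ≤ δ)
    (hdeg : ∀ j : Fin r, δ ≤ 1 - j * (n / partSize m q M j + 1 / (q + 1 : ℝ)))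
    (hsmall : 2 * ((r * Fintype.card V) ^ 2 * η)
      < (1 / (q + 1 : ℝ)) ^ ((r * Fintype.card V) ^ 2) * (δ ^ r) ^ (Fintype.card V ^ r)) :
    InducedArrows (codeGraph m q M) H (starK n) := by
  classical
  intro c
  refine or_iff_not_imp_right.mpr fun hstar => ?_
  have hμ := isProbWeight_uniformPart (q := q) hm hM
  have hpart : ∀ {j : Fin r} {a : CodeVertex m q M}, uniformPart m q M j a ≠ 0 → a.1 = j :=
    fun h => by
      by_contra hne
      exact h (if_neg hne)
  have hq : (1 : ℝ) / (q + 1) ≤ 1 := by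
    rw [div_le_one (by positivity)]
    linarith [(Nat.cast_nonneg q : (0 : ℝ) ≤ q)]
  have hclique := pow_le_sum_clique r (uniformPart m q M) hμ (c.labelGraph true).Adj
    (fun j => n / partSize m q M j + 1 / (q + 1 : ℝ)) hδ
    (fun i j hij a ha => sum_uniformPart_not_red_le hm hM c hstar ((hpart ha).trans_lt hij)) hdeg
  obtain ⟨x, hinj, hsupp, hR, hQ⟩ := exists_injective_pattern H.Adj hμ (c.labelGraph true).Adj
    IsHole (by positivity) hq hη (pow_nonneg hδ r) hclique
    (fun i j _ φ ψ hφ hψ => abs_hole_discrepancy_le hm hM hη hmη i j hφ hψ)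
    (fun j w => (uniformPart_le hm hM j w).trans (hmη.trans (by nlinarith))) hsmall
  have hx : ∀ v, (x (C v, v)).1 = C v := fun v => hpart (hsupp _)
  have hred : ∀ u v, C u < C v → H.Adj u v → (c.labelGraph true).Adj (x (C u, u)) (x (C v, v)) :=
    fun u v h hA => hR (C u, u) (C v, v) h hA
  have hred' : ∀ u v, H.Adj u v → (c.labelGraph true).Adj (x (C u, u)) (x (C v, v)) :=
    fun u v hA => (C.valid hA).lt_or_gt.elim (fun h => hred u v h hA)
      fun h => (hred v u h hA.symm).symm
  have hnon : ∀ u v, C u < C v → ¬ H.Adj u v → ¬ (codeGraph m q M).Adj (x (C u, u)) (x (C v, v)) :=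
    fun u v h hA hadj =>
      (codeGraph_adj_of_lt (by rwa [hx, hx])).mp hadj (hQ (C u, u) (C v, v) h hA)
  have hlab : ∀ u v, H.Adj u v → ∃ h : (codeGraph m q M).Adj (x (C u, u)) (x (C v, v)),
      c.get _ _ h = true := fun u v hA =>
    (SimpleGraph.EdgeLabeling.labelGraph_adj _ _).mp (hred' u v hA)
  refine ⟨⟨⟨fun v => x (C v, v), fun u v h => (Prod.ext_iff.mp (hinj h)).2⟩, fun {u v} => ?_⟩,
    fun u v h => (hlab u v h).2⟩
  refine ⟨fun h => ?_, fun h => (hlab u v h).1⟩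
  by_contra hA
  rcases lt_trichotomy (C u) (C v) with hlt | heq | hgt
  · exact hnon u v hlt hA h
  · exact codeGraph_not_adj_of_eq ((hx u).trans (heq.trans (hx v).symm)) h
  · exact hnon v u hgt (fun h' => hA h'.symm) h.symm

theorem card_codeVertex : Fintype.card (CodeVertex m q M) = ∑ j, partSize m q M j := by
  rw [Fintype.card_sigma]
  exact sum_congr rfl fun j _ => card_part j

end CodeGraph

/-! ### Passage to the Ramsey number and choice of parameters -/

theorem InducedArrows.of_iso {W W' U U' : Type*} {F : SimpleGraph W} {F' : SimpleGraph W'}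
    {H : SimpleGraph U} {G : SimpleGraph U'} (h : InducedArrows F H G) (e : F ≃g F') :
    InducedArrows F' H G := by
  intro c
  rcases h (c.pullback e.toEmbedding.toHom) with ⟨f, hf⟩ | ⟨f, hf⟩
  · exact Or.inl ⟨f.trans e.toEmbedding, hf⟩
  · exact Or.inr ⟨f.trans e.toEmbedding, hf⟩

theorem InducedArrows.card_mem_inducedRamseyOrders {W U U' : Type*} [Fintype W]
    {F : SimpleGraph W} {H : SimpleGraph U} {G : SimpleGraph U'} (h : InducedArrows F H G) :
    Fintype.card W ∈ inducedRamseyOrders H G :=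
  ⟨_, h.of_iso (SimpleGraph.overFinIso F rfl)⟩

/-- The sum is `r * (r - 1) / 2`; this is where the construction's bound is relaxed to the stated
one, with equality for `r = 1` and `r = 2`. -/
theorem sum_fin_val_le (r : ℕ) : ∑ j : Fin r, (j : ℝ) ≤ ((r : ℝ) - 1) ^ 2 := by
  have h : ∑ j : Fin r, (j : ℝ) = r * (r - 1) / 2 := by
    induction r with
    | zero => simp
    | succ r ih =>
      rw [Fin.sum_univ_castSucc]
      simp only [Fin.val_castSucc, Fin.val_last, ih]
      push_cast
      ring
  rw [h]
  rcases r with _ | _ | r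
  · norm_num
  · norm_num
  · push_cast
    nlinarith [(Nat.cast_nonneg r : (0 : ℝ) ≤ r)]

theorem theorem2 {V : Type*} [Finite V] (H : SimpleGraph V) (r : ℕ)
    (hr : H.chromaticNumber = (r : ℕ∞)) (γ : ℝ) (hγ : 0 < γ) :
    ∃ n₀ : ℕ, ∀ n : ℕ, n₀ < n →
      (inducedRamseyOrders H (starK n)).Nonempty ∧
        (inducedRamseyNumber H (starK n) : ℝ) ≤ ((r : ℝ) - 1) ^ 2 * (n : ℝ) + γ * (n : ℝ) := by
  have := Fintype.ofFinite V
  obtain ⟨C⟩ : H.Colorable r := SimpleGraph.chromaticNumber_le_iff_colorable.mp hr.le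
  set p := Fintype.card V
  have hr0 : (0 : ℝ) ≤ r := Nat.cast_nonneg r
  -- The slack `g * n` in each of the `r` parts costs at most `γ / 2 * n` in total.
  set g : ℝ := γ / (2 * (r + 1)) with hg
  have hg0 : 0 < g := by positivity
  -- Chosen so that `j / (j + g) ≤ r / (r + g) = 1 - 2 * δ`: one `δ` absorbs the holes, by the
  -- choice of `q`, and the other remains.
  set δ : ℝ := g / (2 * (r + g)) with hδ
  have hδ0 : 0 < δ := by positivity
  obtain ⟨q, hq⟩ := exists_nat_gt ((r : ℝ) / δ)
  set κ : ℝ := (1 / (q + 1 : ℝ)) ^ ((r * p) ^ 2) * (δ ^ r) ^ (p ^ r) with hκ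
  have hκ0 : 0 < κ := by positivity
  -- The `+ 1` keeps the denominator positive when `r * p = 0`.
  set η : ℝ := min 1 (κ / (2 * ((r * p) ^ 2 + 1))) with hη
  have hη0 : 0 < η := by positivity
  have hsmall : 2 * ((r * p : ℝ) ^ 2 * η) < κ := by
    have h1 : η ≤ κ / (2 * ((r * p) ^ 2 + 1)) := min_le_right _ _
    rw [le_div_iff₀ (by positivity)] at h1
    nlinarith
  obtain ⟨m, hm⟩ := exists_nat_gt (1 / η ^ 2)
  have hm0 : (0 : ℝ) < m := lt_trans (by positivity) hm
  have hmη : 1 / (m : ℝ) ≤ η ^ 2 := by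
    rw [div_lt_iff₀ (by positivity)] at hm
    rw [div_le_iff₀ hm0]
    linarith
  have hmne : m ≠ 0 := by exact_mod_cast hm0.ne'
  set s : ℕ := m * (q + 1) ^ m with hs
  have hs0 : (0 : ℝ) < s := by
    rw [hs]
    positivity
  -- Part sizes are multiples of `s`; rounding up all `r` parts costs at most `r * s ≤ γ / 2 * n`.
  obtain ⟨n₀, hn₀⟩ := exists_nat_gt (2 * r * s / γ)
  refine ⟨n₀, fun n hn => ?_⟩
  have hn0 : (0 : ℝ) < n := by exact_mod_cast (Nat.zero_le n₀).trans_lt hn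
  have hns : r * s ≤ γ / 2 * n := by
    rw [div_lt_iff₀ hγ] at hn₀
    have : (n₀ : ℝ) ≤ n := by exact_mod_cast hn.le
    nlinarith
  -- Part `j` gets about `(j + g) * n` vertices, just more than `j` blue neighbourhoods can cover.
  let M : Fin r → ℕ := fun j => ⌈(j + g) * n / s⌉₊
  have hM : ∀ j, M j ≠ 0 := fun j => (Nat.ceil_pos.mpr (by positivity)).ne'
  have hlow : ∀ j, (j + g) * n ≤ partSize m q M j := fun j => by
    have h1 : (j + g) * n / s ≤ M j := Nat.le_ceil _
    rw [div_le_iff₀ hs0] at h1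
    rw [partSize, ← hs, Nat.cast_mul]
    linarith
  have hupp : ∀ j, (partSize m q M j : ℝ) ≤ (j + g) * n + s := fun j => by
    have h1 : (M j : ℝ) < (j + g) * n / s + 1 := Nat.ceil_lt_add_one (by positivity)
    rw [div_add_one hs0.ne', lt_div_iff₀ hs0] at h1
    rw [partSize, ← hs, Nat.cast_mul]
    linarith
  have hdeg : ∀ j : Fin r, δ ≤ 1 - j * (n / partSize m q M j + 1 / (q + 1 : ℝ)) := fun j => by
    have hj0 : (0 : ℝ) ≤ (j : ℕ) := Nat.cast_nonneg _
    have hjr : ((j : ℕ) : ℝ) ≤ r := by exact_mod_cast j.2.le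
    have h1 : (n : ℝ) / partSize m q M j ≤ 1 / (j + g) := by
      rw [div_le_div_iff₀ (lt_of_lt_of_le (by positivity) (hlow j)) (by positivity)]
      linarith [hlow j]
    have h2 : (j : ℝ) * (1 / (j + g)) ≤ 1 - 2 * δ := by
      have h3 : 1 - 2 * δ = r / (r + g) := by
        rw [hδ]
        field_simp
        ring
      rw [h3, mul_one_div, div_le_div_iff₀ (by positivity) (by positivity)]
      nlinarith
    have h4 : (j : ℝ) * (1 / (q + 1 : ℝ)) ≤ δ := by
      rw [div_lt_iff₀ hδ0] at hq
      rw [mul_one_div, div_le_iff₀ (by positivity)]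
      nlinarith
    have h5 := mul_le_mul_of_nonneg_left h1 hj0
    linarith
  have hmem := (codeGraph_inducedArrows C hmne hM hη0.le (min_le_left _ _) hmη hδ0.le hdeg
    hsmall).card_mem_inducedRamseyOrders
  refine ⟨⟨_, hmem⟩, ?_⟩
  have hle : (inducedRamseyNumber H (starK n) : ℝ) ≤ (Fintype.card (CodeVertex m q M) : ℕ) := by
    exact_mod_cast Nat.sInf_le hmem
  refine hle.trans ?_
  rw [card_codeVertex, Nat.cast_sum]
  calc ∑ j, (partSize m q M j : ℝ) ≤ ∑ j : Fin r, ((j + g) * n + s) :=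
        sum_le_sum fun j _ => hupp j
    _ = (∑ j : Fin r, (j : ℝ)) * n + r * g * n + r * s := by
        simp only [sum_add_distrib, ← sum_mul, sum_const, card_univ, Fintype.card_fin,
          nsmul_eq_mul]
        ring
    _ ≤ ((r : ℝ) - 1) ^ 2 * n + γ / 2 * n + γ / 2 * n := by
        have h1 : r * g ≤ γ / 2 := by
          rw [hg, mul_div_assoc', div_le_div_iff₀ (by positivity) (by positivity)]
          nlinarith
        gcongr
        exact sum_fin_val_le r
    _ = ((r : ℝ) - 1) ^ 2 * n + γ * n := by ring
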